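/- Let $n\ge 1$, let $\mathbb B^{n+1}$ be the unit ball model of $(n+1)$-dimensional hyperbolic space, and let $G$ be a torsion-free Kleinian group acting on it, i.e. a discrete torsion-free group of orientation preserving isometries of $\mathbb B^{n+1}$, so that $M_G=\mathbb B^{n+1}/G$ is a hyperbolic manifold. Let $L(G)\subset\mathbb S^n$ be the limit set of $G$ (the set of accumulation points of an arbitrary $G$-orbit), let $H(L(G))\subset\mathbb B^{n+1}$ be the hyperbolic convex hull of the union of all geodesics both of whose end points lie in $L(G)$, and let $C(M_G)=H(L(G))/G$ be the convex core of $M_G$. Suppose that $C(M_G)$ has bounded geometry in the sense that there is a constant $M>0$ such that the injectivity radius of $M_G$ at every point of $C(M_G)$ is at most $M$. Then every limit point $\xi\in L(G)$ belongs to the big horospheric limit set $L_H(G)$; that is, for every $x\in\mathbb B^{n+1}$ there is a horoball, tangent to $\mathbb S^n$ at $\xi$, that contains infinitely many points of the orbit $Gx$. -/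

import Mathlib

open Set Filter Topology Metric
open scoped NNReal ENNReal

noncomputable section

namespace Hyperbolic

/-- The ambient Euclidean space of dimension `n + 1`. -/
abbrev E (n : ℕ) : Type := EuclideanSpace ℝ (Fin (n + 1))

/-- The open unit ball, the underlying set of the ball model of hyperbolic `(n + 1)`-space. Its
topology (the Euclidean one) is also the topology of the hyperbolic metric. -/
abbrev Ball (n : ℕ) : Type := ↥(Metric.ball (0 : E n) 1)

/-- The unit sphere, the boundary at infinity. -/
abbrev Boundary (n : ℕ) : Set (E n) := Metric.sphere (0 : E n) 1

/-- The hyperbolic distance (curvature `-1`) of the ball model, given by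
`sinh (d / 2) = |x - y| / √((1 - |x|²) (1 - |y|²))`. -/
def hdist {n : ℕ} (x y : Ball n) : ℝ :=
  2 * Real.arsinh (‖(x : E n) - y‖ / √((1 - ‖(x : E n)‖ ^ 2) * (1 - ‖(y : E n)‖ ^ 2)))

/-- Open hyperbolic balls. -/
def hball {n : ℕ} (x : Ball n) (r : ℝ) : Set (Ball n) := {y | hdist x y < r}

/-- A self-map of the unit ball preserves orientation if its Jacobian determinant is positive
everywhere (isometries are smooth; the extension by `0` outside the open ball plays no role). -/
def PreservesOrientation {n : ℕ} (g : Ball n → Ball n) : Prop :=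
  ∀ x : Ball n,
    0 < (fderiv ℝ (Function.extend Subtype.val (fun y => (g y : E n)) (fun _ => 0)) (x : E n)).det

/-- Discreteness of a group of self-bijections of the ball, in the topology of pointwise
convergence; on the isometry group this is the compact-open topology. -/
def IsDiscreteGroup {n : ℕ} (G : Subgroup (Equiv.Perm (Ball n))) : Prop :=
  @DiscreteTopology G
    (TopologicalSpace.induced (fun (g : G) (x : Ball n) => (g : Equiv.Perm (Ball n)) x)
      Pi.topologicalSpace)

/-- Kleinian groups: discrete groups of orientation preserving isometries of hyperbolic space. -/
structure IsKleinian {n : ℕ} (G : Subgroup (Equiv.Perm (Ball n))) : Prop where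
  isometry : ∀ g ∈ G, ∀ x y : Ball n, hdist (g x) (g y) = hdist x y
  orientation : ∀ g ∈ G, PreservesOrientation (g : Ball n → Ball n)
  discrete : IsDiscreteGroup G

/-- No nontrivial element has finite order. -/
def IsTorsionFree {n : ℕ} (G : Subgroup (Equiv.Perm (Ball n))) : Prop :=
  ∀ g ∈ G, IsOfFinOrder g → g = 1

/-- The limit set: the points of the sphere at which an orbit accumulates. For a group of
isometries the accumulation points on the sphere are the same for all orbits. -/
def limitSet {n : ℕ} (G : Subgroup (Equiv.Perm (Ball n))) : Set (E n) :=
  {ξ | ξ ∈ Boundary n ∧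
    ∃ x : Ball n, AccPt ξ (𝓟 ((fun y : Ball n => (y : E n)) '' MulAction.orbit G x))}

/-- `γ` is a complete geodesic, parametrised by arc length, with end points `η` (at `-∞`) and `ξ`
(at `+∞`). -/
structure IsGeodesicLine {n : ℕ} (γ : ℝ → Ball n) (η ξ : E n) : Prop where
  isometry : ∀ s t : ℝ, hdist (γ s) (γ t) = |s - t|
  tendsto_bot : Tendsto (fun t => (γ t : E n)) atBot (𝓝 η)
  tendsto_top : Tendsto (fun t => (γ t : E n)) atTop (𝓝 ξ)

/-- The geodesic segment between two points of hyperbolic space. -/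
def hsegment {n : ℕ} (x y : Ball n) : Set (Ball n) :=
  {z | hdist x z + hdist z y = hdist x y}

/-- Hyperbolic convexity. -/
def HConvex {n : ℕ} (S : Set (Ball n)) : Prop :=
  ∀ x ∈ S, ∀ y ∈ S, hsegment x y ⊆ S

/-- The hyperbolic convex hull of a set: the smallest convex set containing it. -/
def hconvexHull {n : ℕ} (A : Set (Ball n)) : Set (Ball n) :=
  ⋂₀ {S | HConvex S ∧ A ⊆ S}

/-- The union of all complete geodesics both of whose end points lie in `L`. -/
def geodesicUnion {n : ℕ} (L : Set (E n)) : Set (Ball n) :=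
  {x | ∃ η ∈ L, ∃ ξ ∈ L, ∃ γ : ℝ → Ball n, IsGeodesicLine γ η ξ ∧ x ∈ range γ}

/-- The convex hull of the limit set of `G`. -/
def limitHull {n : ℕ} (G : Subgroup (Equiv.Perm (Ball n))) : Set (Ball n) :=
  hconvexHull (geodesicUnion (limitSet G))

/-- The quotient of hyperbolic space by `G`. -/
abbrev QuotientManifold {n : ℕ} (G : Subgroup (Equiv.Perm (Ball n))) : Type :=
  MulAction.orbitRel.Quotient G (Ball n)

/-- The quotient map. -/
def proj {n : ℕ} (G : Subgroup (Equiv.Perm (Ball n))) (x : Ball n) : QuotientManifold G :=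
  Quotient.mk (MulAction.orbitRel G (Ball n)) x

/-- The convex core, as a subset of the quotient. -/
def convexCore {n : ℕ} (G : Subgroup (Equiv.Perm (Ball n))) : Set (QuotientManifold G) :=
  proj G '' limitHull G

/-- The injectivity radius of the quotient at `p`: the supremum of the `r ≥ 0` such that the
quotient map (the Riemannian universal covering, which in a lift of `p` is identified with the
exponential map at `p`) is injective on the open hyperbolic ball of radius `r` about the lifts
of `p`. -/
def injectivityRadius {n : ℕ} (G : Subgroup (Equiv.Perm (Ball n))) (p : QuotientManifold G) :
    ℝ≥0∞ :=
  ⨆ (r : ℝ≥0) (_ : ∀ x : Ball n, proj G x = p → InjOn (proj G) (hball x r)), (r : ℝ≥0∞)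

/-- The convex core has bounded geometry: the injectivity radius is bounded from above on it by a
finite constant. -/
def HasBoundedGeometryCore {n : ℕ} (G : Subgroup (Equiv.Perm (Ball n))) : Prop :=
  ∃ M : ℝ≥0, 0 < M ∧ ∀ p ∈ convexCore G, injectivityRadius G p ≤ (M : ℝ≥0∞)

/-- The open horoball with base point `ξ` on the unit sphere and Euclidean radius `r`: the interior
of the Euclidean sphere of radius `r` inside the unit ball tangent to the unit sphere at `ξ`. -/
def horoball {n : ℕ} (ξ : E n) (r : ℝ) : Set (Ball n) :=
  {x | (x : E n) ∈ Metric.ball ((1 - r) • ξ) r}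

/-- The big horospheric limit set: the limit points `ξ` such that, for every orbit, some horoball
based at `ξ` contains infinitely many points of the orbit. -/
def bigHorosphericLimitSet {n : ℕ} (G : Subgroup (Equiv.Perm (Ball n))) : Set (E n) :=
  {ξ | ξ ∈ limitSet G ∧ ∀ x : Ball n, ∃ r : ℝ, 0 < r ∧ r < 1 ∧
    (MulAction.orbit G x ∩ horoball ξ r).Infinite}

end Hyperbolic

end

noncomputable section

namespace Hyperbolic

variable {n : ℕ}

/-! Suppose there is a limit point `η ≠ ξ`. The geodesic `γ` from `η` to `ξ` lies in the hull, so at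
each `γ k` bounded geometry gives a nontrivial `g k` moving `γ k` by at most `2 * (M + 1)`. Then `g
k x` is at distance at most `k + C` from `γ k`, which bounds its Busemann function at `ξ`
(`IsGeodesicLine.horoLevel_le`): all `g k x` lie in one horoball. If these points form a finite set,
freeness makes one element `g` recur along `γ k → ξ`. As `g` moves those points by a bounded amount,
it fixes `ξ`, hence multiplies `horoLevel ξ` by a constant; the iterates of `g` or of `g⁻¹` stay in
a horoball, and torsion-freeness makes them distinct (`IsKleinian.exists_horoball_of_fixed`). If `ξ`
is the only limit point, every element fixes it and the same lemma applies to any nontrivial one.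
Fixing `ξ` is expressed without a boundary extension: some `z i → ξ` has `g (z i) → ξ`. -/

lemma one_sub_norm_sq_pos (x : Ball n) : 0 < 1 - ‖(x : E n)‖ ^ 2 := by
  have h : ‖(x : E n)‖ < 1 := mem_ball_zero_iff.1 x.2
  nlinarith [norm_nonneg (x : E n)]

/-! ### The hyperbolic distance and its triangle inequality. -/

/-- The quantity `sinh² (d / 2)`, where `d` is the hyperbolic distance. -/
def sinhSq (x y : Ball n) : ℝ :=
  ‖(x : E n) - y‖ ^ 2 / ((1 - ‖(x : E n)‖ ^ 2) * (1 - ‖(y : E n)‖ ^ 2))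

lemma sinh_half_hdist (x y : Ball n) : Real.sinh (hdist x y / 2) =
    ‖(x : E n) - y‖ / √((1 - ‖(x : E n)‖ ^ 2) * (1 - ‖(y : E n)‖ ^ 2)) := by
  rw [hdist, mul_div_cancel_left₀ _ two_ne_zero, Real.sinh_arsinh]

lemma sinhSq_eq (x y : Ball n) : sinhSq x y = Real.sinh (hdist x y / 2) ^ 2 := by
  rw [sinh_half_hdist, div_pow, Real.sq_sqrt, sinhSq]
  exact (mul_pos (one_sub_norm_sq_pos x) (one_sub_norm_sq_pos y)).le

lemma hdist_nonneg (x y : Ball n) : 0 ≤ hdist x y :=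
  mul_nonneg zero_le_two (Real.arsinh_nonneg_iff.2 (by positivity))

lemma hdist_comm (x y : Ball n) : hdist x y = hdist y x := by
  rw [hdist, hdist, norm_sub_rev, mul_comm (1 - ‖(x : E n)‖ ^ 2)]

/-- The quantity `cosh² (d / 2)`, up to the normalising denominator. -/
lemma one_add_sinhSq (x y : Ball n) : 1 + sinhSq x y =
    (1 - 2 * inner ℝ (x : E n) y + ‖(x : E n)‖ ^ 2 * ‖(y : E n)‖ ^ 2) /
      ((1 - ‖(x : E n)‖ ^ 2) * (1 - ‖(y : E n)‖ ^ 2)) := by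
  have hx := (one_sub_norm_sq_pos x).ne'
  have hy := (one_sub_norm_sq_pos y).ne'
  rw [sinhSq, norm_sub_sq_real]
  field_simp
  ring

/-- The right side is the numerator of `cosh² (d / 2)`, so `cosh`, like `sinh`, comes from a
Euclidean distance, here to the inverse of `y` in the unit sphere. -/
lemma norm_mul_dist_inversion_sq {V : Type*} [NormedAddCommGroup V] [InnerProductSpace ℝ V]
    {y : V} (hy : y ≠ 0) (x : V) :
    (‖y‖ * ‖x - (‖y‖ ^ 2)⁻¹ • y‖) ^ 2 = 1 - 2 * inner ℝ x y + ‖x‖ ^ 2 * ‖y‖ ^ 2 := by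
  have h : ‖y‖ ≠ 0 := norm_ne_zero_iff.2 hy
  rw [mul_pow, norm_sub_sq_real, inner_smul_right, norm_smul, Real.norm_of_nonneg (by positivity)]
  field_simp
  ring

/-- Ptolemy's inequality for `x`, `y`, `z` and the inverse of `y` in the unit sphere. -/
lemma norm_sub_mul_le {V : Type*} [NormedAddCommGroup V] [InnerProductSpace ℝ V]
    (x y z : V) (h : ‖y‖ < 1) :
    ‖x - z‖ * (1 - ‖y‖ ^ 2) ≤
      ‖x - y‖ * √(1 - 2 * inner ℝ z y + ‖z‖ ^ 2 * ‖y‖ ^ 2) +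
      √(1 - 2 * inner ℝ x y + ‖x‖ ^ 2 * ‖y‖ ^ 2) * ‖y - z‖ := by
  rcases eq_or_ne y 0 with rfl | hy
  · simpa using norm_sub_le x z
  have hy' : ‖y‖ ≠ 0 := norm_ne_zero_iff.2 hy
  rw [← norm_mul_dist_inversion_sq hy, ← norm_mul_dist_inversion_sq hy,
    Real.sqrt_sq (by positivity), Real.sqrt_sq (by positivity)]
  set w := (‖y‖ ^ 2)⁻¹ • y with hw
  have key := EuclideanGeometry.mul_dist_le_mul_dist_add_mul_dist x y z w
  simp only [dist_eq_norm] at key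
  have hyw : ‖y‖ * ‖y - w‖ = 1 - ‖y‖ ^ 2 := by
    have e : y - w = -((1 - ‖y‖ ^ 2) * (‖y‖ ^ 2)⁻¹) • y := by
      rw [hw, neg_smul, sub_mul, mul_inv_cancel₀ (by positivity), sub_smul, one_mul, one_smul,
        neg_sub]
    have : 0 ≤ 1 - ‖y‖ ^ 2 := by nlinarith [norm_nonneg y]
    rw [e, norm_smul, norm_neg, Real.norm_of_nonneg (by positivity)]
    field_simp
  rw [← hyw]
  calc ‖x - z‖ * (‖y‖ * ‖y - w‖) = ‖y‖ * (‖x - z‖ * ‖y - w‖) := by ring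
    _ ≤ ‖y‖ * (‖x - y‖ * ‖z - w‖ + ‖y - z‖ * ‖x - w‖) := by gcongr
    _ = _ := by ring

lemma cosh_half_hdist (x y : Ball n) : Real.cosh (hdist x y / 2) =
    √(1 - 2 * inner ℝ (x : E n) y + ‖(x : E n)‖ ^ 2 * ‖(y : E n)‖ ^ 2) /
      √((1 - ‖(x : E n)‖ ^ 2) * (1 - ‖(y : E n)‖ ^ 2)) := by
  rw [← Real.sqrt_div' _ (mul_pos (one_sub_norm_sq_pos x) (one_sub_norm_sq_pos y)).le,
    ← one_add_sinhSq, sinhSq_eq, add_comm, ← Real.cosh_sq, Real.sqrt_sq (Real.cosh_pos _).le]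

/-- Expanded by the addition formula for `sinh` and cleared of denominators, this is the Ptolemy
inequality `norm_sub_mul_le`. -/
lemma hdist_triangle (x y z : Ball n) : hdist x z ≤ hdist x y + hdist y z := by
  suffices hdist x z / 2 ≤ hdist x y / 2 + hdist y z / 2 by linarith
  have hx := one_sub_norm_sq_pos x
  have hy := one_sub_norm_sq_pos y
  have hz := one_sub_norm_sq_pos z
  have key := norm_sub_mul_le (x : E n) y z (mem_ball_zero_iff.1 y.2)
  rw [← Real.sinh_le_sinh, Real.sinh_add, cosh_half_hdist x y, hdist_comm y z,
    cosh_half_hdist z y, sinh_half_hdist, sinh_half_hdist, sinh_half_hdist,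
    Real.sqrt_mul hx.le, Real.sqrt_mul hx.le, Real.sqrt_mul hz.le]
  have hb := Real.sq_sqrt hy.le
  rw [← hb] at key
  have ha := Real.sqrt_pos.2 hx
  have hb := Real.sqrt_pos.2 hy
  have hc := Real.sqrt_pos.2 hz
  rw [norm_sub_rev (z : E n) y]
  generalize √(1 - ‖(x : E n)‖ ^ 2) = a at *
  generalize √(1 - ‖(y : E n)‖ ^ 2) = b at *
  generalize √(1 - ‖(z : E n)‖ ^ 2) = c at *
  rw [div_mul_div_comm, div_mul_div_comm, show c * b = b * c by ring, ← add_div,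
    div_le_div_iff₀ (by positivity) (by positivity)]
  nlinarith [mul_le_mul_of_nonneg_left key (mul_pos ha hc).le]

lemma sinhSq_pos_mul (x y : Ball n) : sinhSq x y * ((1 - ‖(x : E n)‖ ^ 2) *
    (1 - ‖(y : E n)‖ ^ 2)) = ‖(x : E n) - y‖ ^ 2 :=
  div_mul_cancel₀ _ (mul_pos (one_sub_norm_sq_pos x) (one_sub_norm_sq_pos y)).ne'

/-- As `y → ξ` the left side tends to `horoLevel ξ x`, while on the right the non-metric factor
depends on `y` alone and cancels in ratios. -/
lemma norm_sub_sq_div (x y : Ball n) : ‖(x : E n) - y‖ ^ 2 / (1 - ‖(x : E n)‖ ^ 2) =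
    sinhSq x y * (1 - ‖(y : E n)‖ ^ 2) := by
  have := (one_sub_norm_sq_pos x).ne'
  have := (one_sub_norm_sq_pos y).ne'
  rw [sinhSq]
  field_simp

lemma sinhSq_eq_of_hdist_eq {x y x' y' : Ball n} (h : hdist x y = hdist x' y') :
    sinhSq x y = sinhSq x' y' := by rw [sinhSq_eq, sinhSq_eq, h]

lemma sinhSq_le_of_hdist_le {x y : Ball n} {r : ℝ} (h : hdist x y ≤ r) :
    sinhSq x y ≤ Real.sinh (r / 2) ^ 2 := by
  rw [sinhSq_eq]
  have := hdist_nonneg x y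
  exact pow_le_pow_left₀ (Real.sinh_nonneg_iff.2 (by linarith))
    (Real.sinh_le_sinh.2 (by linarith)) 2

lemma sinhSq_nonneg (x y : Ball n) : 0 ≤ sinhSq x y := by
  rw [sinhSq_eq]; positivity

lemma norm_sub_sq_le (x y : Ball n) :
    ‖(x : E n) - y‖ ^ 2 ≤ sinhSq x y * (1 - ‖(x : E n)‖ ^ 2) := by
  rw [← sinhSq_pos_mul]
  have h := one_sub_norm_sq_pos x
  have h' : 1 - ‖(y : E n)‖ ^ 2 ≤ 1 := by nlinarith [sq_nonneg ‖(y : E n)‖]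
  have h2 := sinhSq_nonneg x y
  rw [← mul_assoc]
  exact mul_le_of_le_one_right (by positivity) h'

/-! ### Sequences approaching the sphere. -/

/-- Points at bounded hyperbolic distance from points converging to the sphere converge to the
same limit. -/
lemma tendsto_of_hdist_le {ι : Type*} {l : Filter ι} {z w : ι → Ball n} {ξ : E n} {C : ℝ}
    (hξ : ξ ∈ Boundary n) (hz : Tendsto (fun i => (z i : E n)) l (𝓝 ξ))
    (h : ∀ᶠ i in l, hdist (z i) (w i) ≤ C) : Tendsto (fun i => (w i : E n)) l (𝓝 ξ) := by
  have h1 : Tendsto (fun i => Real.sinh (C / 2) ^ 2 * (1 - ‖(z i : E n)‖ ^ 2)) l (𝓝 0) := by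
    have := ((hz.norm.pow 2).const_sub 1).const_mul (Real.sinh (C / 2) ^ 2)
    have hn : ‖ξ‖ = 1 := by simpa using hξ
    simpa [hn] using this
  have h2 : Tendsto (fun i => ‖(z i : E n) - w i‖ ^ 2) l (𝓝 0) := by
    refine squeeze_zero' (Eventually.of_forall fun i => by positivity) ?_ h1
    filter_upwards [h] with i hi
    exact (norm_sub_sq_le _ _).trans
      (mul_le_mul_of_nonneg_right (sinhSq_le_of_hdist_le hi) (one_sub_norm_sq_pos _).le)
  have h3 : Tendsto (fun i => (z i : E n) - w i) l (𝓝 0) := by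
    rw [tendsto_zero_iff_norm_tendsto_zero]
    simpa using h2.sqrt
  simpa using hz.sub h3

/-- Limits of points that stay at bounded hyperbolic distance from a given point. -/
lemma norm_lt_one_of_tendsto {ι : Type*} {l : Filter ι} [l.NeBot] {z : ι → Ball n} {w : E n}
    {x : Ball n} {C : ℝ} (hz : Tendsto (fun i => (z i : E n)) l (𝓝 w))
    (h : ∀ᶠ i in l, hdist (z i) x ≤ C) : ‖w‖ < 1 := by
  have h1 : ‖w - x‖ ^ 2 ≤ Real.sinh (C / 2) ^ 2 * (1 - ‖w‖ ^ 2) := by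
    refine le_of_tendsto_of_tendsto ((hz.sub_const (x : E n)).norm.pow 2)
      (((hz.norm.pow 2).const_sub 1).const_mul _) ?_
    filter_upwards [h] with i hi
    exact (norm_sub_sq_le _ _).trans
      (mul_le_mul_of_nonneg_right (sinhSq_le_of_hdist_le hi) (one_sub_norm_sq_pos _).le)
  have hle : ‖w‖ ≤ 1 := le_of_tendsto hz.norm (Eventually.of_forall fun i => by
    have := (z i).2
    rw [mem_ball_zero_iff] at this
    exact this.le)
  refine lt_of_le_of_ne hle fun h2 => ?_
  rw [h2] at h1
  have h3 : ‖w - x‖ ^ 2 ≤ 0 := by simpa using h1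
  have h4 : w = x := by
    rw [← sub_eq_zero, ← norm_eq_zero]
    exact pow_eq_zero_iff two_ne_zero |>.1 (le_antisymm h3 (by positivity))
  have := x.2
  rw [mem_ball_zero_iff, ← h4, h2] at this
  exact lt_irrefl _ this

lemma exists_tendsto_ultrafilter {ι : Type*} (U : Ultrafilter ι) (z : ι → Ball n) :
    ∃ w : E n, Tendsto (fun i => (z i : E n)) U (𝓝 w) := by
  obtain ⟨w, -, hw⟩ := (isCompact_closedBall (0 : E n) 1).ultrafilter_le_nhds
    (U.map fun i => (z i : E n)) (by
      rw [le_principal_iff]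
      exact mem_map.2 (Eventually.of_forall fun i => ball_subset_closedBall (z i).2))
  exact ⟨w, hw⟩

/-! ### Proper discontinuity and freeness. -/

section Group

variable {G : Subgroup (Equiv.Perm (Ball n))}

lemma IsKleinian.sinhSq_map (hG : IsKleinian G) {g : Equiv.Perm (Ball n)} (hg : g ∈ G)
    (x y : Ball n) : sinhSq (g x) (g y) = sinhSq x y :=
  sinhSq_eq_of_hdist_eq (hG.isometry g hg x y)

/-- A Kleinian group acts properly discontinuously. -/
lemma IsKleinian.finite_hdist_le (hG : IsKleinian G) (x : Ball n) (R : ℝ) :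
    {g : G | hdist ((g : Equiv.Perm (Ball n)) x) x ≤ R}.Finite := by
  by_contra hinf
  set T := {g : G | hdist ((g : Equiv.Perm (Ball n)) x) x ≤ R}
  have : Infinite T := Set.infinite_coe_iff.2 hinf
  -- Along a nonprincipal ultrafilter every `i y` converges inside the ball, so `i⁻¹ * j → 1`
  -- pointwise, and discreteness makes it eventually `1`.
  let U : Ultrafilter T := hyperfilter T
  have hT : ∀ (i : T) (y : Ball n), hdist (((i : G) : Equiv.Perm (Ball n)) y) x ≤ hdist y x + R := by
    intro i y
    refine (hdist_triangle _ (((i : G) : Equiv.Perm (Ball n)) x) _).trans ?_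
    rw [hG.isometry _ (i : G).2]
    exact add_le_add_right i.2 _
  have hlim : ∀ y : Ball n, Tendsto (fun p : T × T =>
      (((p.1 : G)⁻¹ * (p.2 : G) : G) : Equiv.Perm (Ball n)) y) ((U : Filter T) ×ˢ (U : Filter T))
      (𝓝 y) := by
    intro y
    obtain ⟨w, hw⟩ := exists_tendsto_ultrafilter U fun i : T => ((i : G) : Equiv.Perm (Ball n)) y
    have hw1 : ‖w‖ < 1 := norm_lt_one_of_tendsto hw (Eventually.of_forall fun i => hT i y)
    have t1 := hw.comp (tendsto_fst (f := (U : Filter T)) (g := (U : Filter T)))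
    have t2 := hw.comp (tendsto_snd (f := (U : Filter T)) (g := (U : Filter T)))
    have hpos : 0 < 1 - ‖w‖ ^ 2 := by nlinarith [norm_nonneg w]
    have t3 := ((t1.sub t2).norm.pow 2).div
      (((t1.norm.pow 2).const_sub 1).mul ((t2.norm.pow 2).const_sub 1)) (by positivity)
    have t4 : Tendsto (fun p : T × T => sinhSq (((p.1 : G) : Equiv.Perm (Ball n)) y)
        (((p.2 : G) : Equiv.Perm (Ball n)) y)) ((U : Filter T) ×ˢ (U : Filter T)) (𝓝 0) := by
      have h0 : ‖w - w‖ ^ 2 / ((1 - ‖w‖ ^ 2) * (1 - ‖w‖ ^ 2)) = 0 := by simp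
      rw [h0] at t3
      exact t3
    rw [tendsto_subtype_rng, tendsto_iff_norm_sub_tendsto_zero]
    have t5 : Tendsto (fun p : T × T =>
        ‖((((p.1 : G)⁻¹ * (p.2 : G) : G) : Equiv.Perm (Ball n)) y : E n) - y‖ ^ 2)
        ((U : Filter T) ×ˢ (U : Filter T)) (𝓝 0) := by
      refine squeeze_zero (fun p => by positivity) (fun p => ?_) t4
      rw [← hG.sinhSq_map (p.1 : G)⁻¹.2]
      rw [norm_sub_rev]
      have e : (((p.1 : G)⁻¹ : G) : Equiv.Perm (Ball n)) (((p.1 : G) : Equiv.Perm (Ball n)) y)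
          = y := by simp
      rw [e]
      refine (norm_sub_sq_le _ _).trans (mul_le_of_le_one_right (sinhSq_nonneg _ _) ?_)
      nlinarith [sq_nonneg ‖(y : E n)‖]
    simpa using t5.sqrt
  let : TopologicalSpace G :=
    TopologicalSpace.induced (fun (g : G) (x : Ball n) => (g : Equiv.Perm (Ball n)) x)
      Pi.topologicalSpace
  have : DiscreteTopology G := hG.discrete
  have hone : Tendsto (fun p : T × T => (p.1 : G)⁻¹ * (p.2 : G))
      ((U : Filter T) ×ˢ (U : Filter T)) (𝓝 (1 : G)) := by
    rw [nhds_induced, tendsto_comap_iff, tendsto_pi_nhds]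
    intro y
    simpa using hlim y
  rw [nhds_discrete, tendsto_pure] at hone
  -- For this fixed `i`, almost every `j` equals `i`, although `{i}` is finite and hence not in the
  -- hyperfilter.
  obtain ⟨i, hi⟩ := hone.curry.exists
  have hfin : {j : T | j = i}.Finite := by simp
  refine (hi.and hfin.compl_mem_hyperfilter).exists.elim fun j hj => hj.2 ?_
  exact Subtype.ext (inv_mul_eq_one.1 hj.1).symm

/-- A torsion-free Kleinian group acts freely. -/
lemma IsKleinian.eq_one_of_fixed (hG : IsKleinian G) (htf : IsTorsionFree G)
    {g : Equiv.Perm (Ball n)} (hg : g ∈ G) {x : Ball n} (hx : g x = x) : g = 1 := by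
  refine htf g hg ?_
  have hfix : ∀ k : ℕ, (g ^ k) x = x := by
    intro k
    induction k with
    | zero => simp
    | succ k ih => rw [pow_succ, Equiv.Perm.mul_apply, hx, ih]
  by_contra hne
  -- With infinite order, the powers of `g` would be infinitely many elements fixing `x`.
  refine Set.infinite_range_of_injective (f := fun k : ℕ => (⟨g, hg⟩ : G) ^ k) ?_
    ((hG.finite_hdist_le x (hdist x x)).subset ?_)
  · exact fun a b hab =>
      injective_pow_iff_not_isOfFinOrder.2 hne (congrArg Subtype.val hab)
  · rintro _ ⟨k, rfl⟩
    simp [hfix k]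

lemma IsKleinian.eq_of_apply_eq (hG : IsKleinian G) (htf : IsTorsionFree G)
    {g h : Equiv.Perm (Ball n)} (hg : g ∈ G) (hh : h ∈ G) {x : Ball n} (hx : g x = h x) :
    g = h := by
  have := hG.eq_one_of_fixed htf (G.mul_mem (G.inv_mem hg) hh) (x := x) (by simp [← hx])
  exact inv_mul_eq_one.1 this

lemma IsKleinian.pow_apply_injective (hG : IsKleinian G) (htf : IsTorsionFree G)
    {g : Equiv.Perm (Ball n)} (hg : g ∈ G) (h1 : g ≠ 1) (x : Ball n) :
    Function.Injective fun k : ℕ => (g ^ k) x := by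
  have hinj : Function.Injective fun k : ℕ => g ^ k :=
    injective_pow_iff_not_isOfFinOrder.2 fun h => h1 (htf g hg h)
  exact fun k m hkm => hinj (hG.eq_of_apply_eq htf (G.pow_mem hg k) (G.pow_mem hg m) hkm)

end Group

/-! ### Horospheres and the Busemann function. -/

/-- The horospherical level function at `ξ` (the exponential of the Busemann function). -/
def horoLevel (ξ : E n) (x : Ball n) : ℝ := ‖(x : E n) - ξ‖ ^ 2 / (1 - ‖(x : E n)‖ ^ 2)

lemma horoLevel_pos {ξ : E n} (hξ : ξ ∈ Boundary n) (x : Ball n) : 0 < horoLevel ξ x := by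
  have : (x : E n) - ξ ≠ 0 := fun h => by
    have h1 := mem_ball_zero_iff.1 x.2
    rw [sub_eq_zero.1 h, mem_sphere_zero_iff_norm.1 hξ] at h1
    exact lt_irrefl _ h1
  exact div_pos (by positivity) (one_sub_norm_sq_pos x)

/-- The horosphere of Euclidean radius `r` meets the diameter through `ξ` at `(1 - 2 * r) • ξ`,
where the level is `r / (1 - r)`; solving for `r` gives `c / (1 + c)`. -/
lemma mem_horoball_of_horoLevel_lt {ξ : E n} (hξ : ξ ∈ Boundary n) {c : ℝ} (hc : 0 < c)
    {x : Ball n} (hx : horoLevel ξ x < c) : x ∈ horoball ξ (c / (1 + c)) := by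
  have hn : ‖ξ‖ = 1 := mem_sphere_zero_iff_norm.1 hξ
  have h1 := one_sub_norm_sq_pos x
  rw [horoLevel, div_lt_iff₀ h1, norm_sub_sq_real, hn] at hx
  change (x : E n) ∈ Metric.ball _ _
  rw [mem_ball_iff_norm]
  refine lt_of_pow_lt_pow_left₀ 2 (by positivity) ?_
  rw [norm_sub_sq_real, norm_smul, inner_smul_right, hn, mul_one, Real.norm_eq_abs, sq_abs]
  have e : 1 - c / (1 + c) = 1 / (1 + c) := by field_simp; ring
  rw [e, ← sub_pos]
  have e2 : (c / (1 + c)) ^ 2 - (‖(x : E n)‖ ^ 2 - 2 * (1 / (1 + c) * inner ℝ (x : E n) ξ) +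
      (1 / (1 + c)) ^ 2) = (c * (1 - ‖(x : E n)‖ ^ 2) -
        (‖(x : E n)‖ ^ 2 - 2 * inner ℝ (x : E n) ξ + 1 ^ 2)) / (1 + c) := by
    field_simp
    ring
  rw [e2]
  exact div_pos (by linarith) (by positivity)

/-- If an isometry fixes the boundary point `ξ`, it permutes the horospheres at `ξ`. -/
lemma horoLevel_mul_eq {ι : Type*} {l : Filter ι} [l.NeBot] {z : ι → Ball n} {ξ : E n}
    {g : Ball n → Ball n} (hg : ∀ x y, hdist (g x) (g y) = hdist x y)
    (hz : Tendsto (fun i => (z i : E n)) l (𝓝 ξ))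
    (hgz : Tendsto (fun i => (g (z i) : E n)) l (𝓝 ξ)) (x y : Ball n) :
    horoLevel ξ (g x) * horoLevel ξ y = horoLevel ξ (g y) * horoLevel ξ x := by
  have hlim : ∀ x y : Ball n, Tendsto
      (fun i => ‖(g x : E n) - g (z i)‖ ^ 2 / (1 - ‖(g x : E n)‖ ^ 2) *
        (‖(y : E n) - z i‖ ^ 2 / (1 - ‖(y : E n)‖ ^ 2))) l
      (𝓝 (horoLevel ξ (g x) * horoLevel ξ y)) := fun x y =>
    (((hgz.const_sub _).norm.pow 2).div_const _).mul (((hz.const_sub _).norm.pow 2).div_const _)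
  refine tendsto_nhds_unique (hlim x y) ((hlim y x).congr fun i => ?_)
  -- After cancelling equal distances, both products carry the same factors `1 - ‖z i‖²` and `1 - ‖g
  -- (z i)‖²`.
  have hx := sinhSq_eq_of_hdist_eq (hg x (z i))
  have hy := sinhSq_eq_of_hdist_eq (hg y (z i))
  rw [norm_sub_sq_div, norm_sub_sq_div, norm_sub_sq_div, norm_sub_sq_div, hx, hy]
  ring

/-! ### Orbits in horoballs: elements fixing `ξ`, and a single limit point. -/

section Group

variable {G : Subgroup (Equiv.Perm (Ball n))}

lemma exists_horoball_of_infinite {ξ : E n} (hξ : ξ ∈ Boundary n) {x : Ball n} {C : ℝ}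
    {S : Set (Ball n)} (hS : S.Infinite) (hSG : S ⊆ MulAction.orbit G x)
    (hC : ∀ y ∈ S, horoLevel ξ y ≤ C) :
    ∃ r : ℝ, 0 < r ∧ r < 1 ∧ (MulAction.orbit G x ∩ horoball ξ r).Infinite := by
  obtain ⟨y, hy⟩ := hS.nonempty
  have hC0 : 0 < C := (horoLevel_pos hξ y).trans_le (hC y hy)
  -- The horoball is open and the bound `C` is not strict, hence `C + 1`.
  refine ⟨(C + 1) / (1 + (C + 1)), by positivity, ?_, hS.mono fun y hy => ⟨hSG hy, ?_⟩⟩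
  · rw [div_lt_one (by positivity)]
    linarith
  · exact mem_horoball_of_horoLevel_lt hξ (by linarith) (by linarith [hC y hy])

/-- A nontrivial element fixing `ξ` has infinitely many iterates, or infinitely many inverse
iterates, of a given point in a horoball at `ξ`. -/
lemma IsKleinian.exists_horoball_of_fixed (hG : IsKleinian G) (htf : IsTorsionFree G)
    {ι : Type*} {l : Filter ι} [l.NeBot] {z : ι → Ball n} {ξ : E n} (hξ : ξ ∈ Boundary n)
    {g : Equiv.Perm (Ball n)} (hg : g ∈ G) (h1 : g ≠ 1)
    (hz : Tendsto (fun i => (z i : E n)) l (𝓝 ξ))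
    (hgz : Tendsto (fun i => (g (z i) : E n)) l (𝓝 ξ)) (x : Ball n) :
    ∃ r : ℝ, 0 < r ∧ r < 1 ∧ (MulAction.orbit G x ∩ horoball ξ r).Infinite := by
  have hmul := horoLevel_mul_eq (hG.isometry g hg) hz hgz
  have hmain : ∀ h ∈ G, h ≠ 1 → (∀ y, horoLevel ξ (h y) ≤ horoLevel ξ y) →
      ∃ r : ℝ, 0 < r ∧ r < 1 ∧ (MulAction.orbit G x ∩ horoball ξ r).Infinite := by
    intro h hh hh1 hle
    refine exists_horoball_of_infinite hξ (C := horoLevel ξ x)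
      (infinite_range_of_injective (hG.pow_apply_injective htf hh hh1 x)) ?_ ?_
    · rintro _ ⟨k, rfl⟩
      exact ⟨⟨h ^ k, G.pow_mem hh k⟩, rfl⟩
    · rintro _ ⟨k, rfl⟩
      induction k with
      | zero => simp
      | succ k ih =>
        simp only [pow_succ', Equiv.Perm.mul_apply]
        exact (hle _).trans ih
  have hp := horoLevel_pos hξ
  -- The scaling factor of `horoLevel ξ` under `g` is independent of the point, so comparing at `x`
  -- decides whether `g` or `g⁻¹` is non-increasing everywhere.
  rcases le_total (horoLevel ξ (g x)) (horoLevel ξ x) with hx | hx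
  · refine hmain g hg h1 fun y => le_of_mul_le_mul_right ?_ (hp x)
    rw [hmul y x, mul_comm]
    exact mul_le_mul_of_nonneg_left hx (hp y).le
  · refine hmain g⁻¹ (G.inv_mem hg) (inv_ne_one.2 h1) fun y => le_of_mul_le_mul_right ?_ (hp x)
    have := hmul x (g⁻¹ y)
    rw [show g (g⁻¹ y) = y from g.apply_symm_apply y] at this
    rw [← this, mul_comm]
    exact mul_le_mul_of_nonneg_right hx (hp _).le

/-- Translates of a sequence of orbit points converging to the sphere accumulate only at limit
points. -/
lemma IsKleinian.mem_limitSet_of_tendsto (hG : IsKleinian G) {x : Ball n} {U : Ultrafilter G}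
    {ξ : E n} (hξ : ξ ∈ Boundary n)
    (hU : Tendsto (fun g : G => ((g : Equiv.Perm (Ball n)) x : E n)) U (𝓝 ξ))
    (h : G) {ζ : E n}
    (hζ : Tendsto (fun g : G => ((h : Equiv.Perm (Ball n)) ((g : Equiv.Perm (Ball n)) x) : E n))
      U (𝓝 ζ)) : ζ ∈ limitSet G := by
  have hle : ‖ζ‖ ≤ 1 := le_of_tendsto hζ.norm (Eventually.of_forall fun i =>
    (mem_ball_zero_iff.1 (Subtype.prop _)).le)
  have hb : ζ ∈ Boundary n := by
    rw [mem_sphere_zero_iff_norm]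
    refine le_antisymm hle (not_lt.1 fun hlt => ?_)
    set w : Ball n := ⟨ζ, mem_ball_zero_iff.2 hlt⟩
    set v := (h : Equiv.Perm (Ball n))⁻¹ w
    -- Were `ζ` inside the ball, equality of the distances from `g x` to `v` and from `h (g x)` to
    -- `w`, cross-multiplied, would give in the limit a positive number equal to `0`.
    have t := (((hU.sub_const (v : E n)).norm.pow 2).mul
      (((hζ.norm.pow 2).const_sub 1).mul_const (1 - ‖(w : E n)‖ ^ 2)))
    have t' := ((hζ.sub_const (w : E n)).norm.pow 2).mul
      (((hU.norm.pow 2).const_sub 1).mul_const (1 - ‖(v : E n)‖ ^ 2))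
    have := tendsto_nhds_unique t (t'.congr fun g => ?_)
    · have hn : ‖ξ‖ = 1 := mem_sphere_zero_iff_norm.1 hξ
      have h1 : 0 < ‖ξ - v‖ ^ 2 := by
        have := horoLevel_pos hξ v
        rw [horoLevel, div_pos_iff_of_pos_right (one_sub_norm_sq_pos v), norm_sub_rev] at this
        exact this
      have h2 : 0 < 1 - ‖ζ‖ ^ 2 := one_sub_norm_sq_pos w
      have h3 : 0 < 1 - ‖(w : E n)‖ ^ 2 := one_sub_norm_sq_pos w
      rw [hn] at this
      have h4 : 0 < ‖ξ - v‖ ^ 2 * ((1 - ‖ζ‖ ^ 2) * (1 - ‖(w : E n)‖ ^ 2)) := by positivity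
      rw [this] at h4
      simp at h4
    · have e := hG.sinhSq_map h.2 ((g : Equiv.Perm (Ball n)) x) v
      rw [show (h : Equiv.Perm (Ball n)) v = w from Equiv.apply_symm_apply _ w] at e
      rw [← sinhSq_pos_mul, ← sinhSq_pos_mul, e]
      ring
  refine ⟨hb, x, ?_⟩
  rw [accPt_iff_frequently]
  refine hζ.frequently (Eventually.frequently (Eventually.of_forall fun g => ⟨?_, ?_⟩))
  · intro hc
    have h1 := mem_ball_zero_iff.1
      ((h : Equiv.Perm (Ball n)) ((g : Equiv.Perm (Ball n)) x)).2
    rw [hc, mem_sphere_zero_iff_norm.1 hb] at h1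
    exact lt_irrefl _ h1
  · exact mem_image_of_mem _ ⟨h * g, rfl⟩

lemma exists_ultrafilter_of_mem_limitSet {ξ : E n} (hξ : ξ ∈ limitSet G) :
    ∃ (x : Ball n) (U : Ultrafilter G),
      Tendsto (fun g : G => ((g : Equiv.Perm (Ball n)) x : E n)) U (𝓝 ξ) := by
  obtain ⟨-, x, hx⟩ := hξ
  rw [accPt_iff_frequently] at hx
  have : (comap (fun g : G => ((g : Equiv.Perm (Ball n)) x : E n)) (𝓝 ξ)).NeBot := by
    rw [comap_neBot_iff_frequently]
    refine hx.mono ?_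
    rintro _ ⟨-, _, ⟨g, rfl⟩, rfl⟩
    exact ⟨g, rfl⟩
  exact ⟨x, Ultrafilter.of _, tendsto_comap.mono_left (Ultrafilter.of_le _)⟩

/-- The case of a single limit point. -/
lemma IsKleinian.exists_horoball_of_limitSet_subsingleton (hG : IsKleinian G)
    (htf : IsTorsionFree G) {ξ : E n} (hξ : ξ ∈ limitSet G) (hL : ∀ η ∈ limitSet G, η = ξ)
    (x : Ball n) :
    ∃ r : ℝ, 0 < r ∧ r < 1 ∧ (MulAction.orbit G x ∩ horoball ξ r).Infinite := by
  obtain ⟨x₀, U, hU⟩ := exists_ultrafilter_of_mem_limitSet hξ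
  obtain ⟨h, hh⟩ : ∃ h : G, h ≠ 1 := by
    by_contra! hc
    have h1 : Tendsto (fun g : G => ((g : Equiv.Perm (Ball n)) x₀ : E n)) U (𝓝 (x₀ : E n)) :=
      tendsto_const_nhds.congr fun g => by simp [hc g]
    have h2 := mem_ball_zero_iff.1 x₀.2
    rw [tendsto_nhds_unique h1 hU, mem_sphere_zero_iff_norm.1 hξ.1] at h2
    exact lt_irrefl _ h2
  obtain ⟨ζ, hζ⟩ := exists_tendsto_ultrafilter U
    fun g : G => (h : Equiv.Perm (Ball n)) ((g : Equiv.Perm (Ball n)) x₀)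
  have hζξ := hL ζ (hG.mem_limitSet_of_tendsto hξ.1 hU h hζ)
  exact hG.exists_horoball_of_fixed htf hξ.1 h.2 (fun hc => hh (Subtype.ext hc)) hU
    (hζξ ▸ hζ) x

end Group

/-! ### Explicit geodesics and their horospherical estimate. -/

section Geodesic

/-- The denominator in the parametrisation of the geodesic from `η` to `ξ`. -/
def geodesicDenom (η ξ : E n) (t : ℝ) : ℝ := ‖ξ - η‖ + Real.exp t + (Real.exp t)⁻¹

lemma geodesicDenom_pos (η ξ : E n) (t : ℝ) : 0 < geodesicDenom η ξ t := by
  unfold geodesicDenom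
  positivity

/-- The geodesic from `η` to `ξ`, as a curve in Euclidean space. -/
def geodesicCurve (η ξ : E n) (t : ℝ) : E n :=
  (geodesicDenom η ξ t)⁻¹ • (Real.exp t • ξ + (Real.exp t)⁻¹ • η)

lemma two_mul_inner_eq {η ξ : E n} (hη : η ∈ Boundary n) (hξ : ξ ∈ Boundary n) :
    2 * inner ℝ ξ η = 2 - ‖ξ - η‖ ^ 2 := by
  rw [norm_sub_sq_real, mem_sphere_zero_iff_norm.1 hη, mem_sphere_zero_iff_norm.1 hξ]
  ring

lemma norm_smul_add_smul_sq {η ξ : E n} (hη : η ∈ Boundary n) (hξ : ξ ∈ Boundary n) (a b : ℝ) :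
    ‖a • ξ + b • η‖ ^ 2 = (a + b) ^ 2 - a * b * ‖ξ - η‖ ^ 2 := by
  have h := two_mul_inner_eq hη hξ
  rw [norm_add_sq_real, norm_smul, norm_smul, inner_smul_left, inner_smul_right,
    mem_sphere_zero_iff_norm.1 hη, mem_sphere_zero_iff_norm.1 hξ, mul_pow, mul_pow,
    Real.norm_eq_abs, Real.norm_eq_abs, sq_abs, sq_abs]
  simp only [conj_trivial]
  linear_combination a * b * h

/-- In the hyperboloid model the geodesic is `(e^t (1, ξ) + e^(-t) (1, η)) / ‖ξ - η‖`; projecting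
`(X₀, X)` to `X / (1 + X₀)` gives `geodesicCurve`. -/
lemma one_sub_norm_geodesicCurve_sq {η ξ : E n} (hη : η ∈ Boundary n) (hξ : ξ ∈ Boundary n)
    (t : ℝ) : 1 - ‖geodesicCurve η ξ t‖ ^ 2 = 2 * ‖ξ - η‖ / geodesicDenom η ξ t := by
  have hD := (geodesicDenom_pos η ξ t).ne'
  rw [geodesicCurve, norm_smul, mul_pow, norm_smul_add_smul_sq hη hξ, Real.norm_eq_abs, sq_abs]
  field_simp
  unfold geodesicDenom
  have hp := Real.exp_pos t
  generalize Real.exp t = p at *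
  field_simp
  ring

lemma norm_geodesicCurve_sub_sq {η ξ : E n} (hη : η ∈ Boundary n) (hξ : ξ ∈ Boundary n)
    (s t : ℝ) : ‖geodesicCurve η ξ s - geodesicCurve η ξ t‖ ^ 2 =
      Real.sinh ((s - t) / 2) ^ 2 *
      (2 * ‖ξ - η‖ / geodesicDenom η ξ s * (2 * ‖ξ - η‖ / geodesicDenom η ξ t)) := by
  have hs := (geodesicDenom_pos η ξ s).ne'
  have ht := (geodesicDenom_pos η ξ t).ne'
  have e : geodesicCurve η ξ s - geodesicCurve η ξ t =
      (Real.exp s / geodesicDenom η ξ s - Real.exp t / geodesicDenom η ξ t) • ξ +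
      ((Real.exp s)⁻¹ / geodesicDenom η ξ s - (Real.exp t)⁻¹ / geodesicDenom η ξ t) • η := by
    unfold geodesicCurve
    module
  rw [e, norm_smul_add_smul_sq hη hξ]
  have h1 : Real.sinh ((s - t) / 2) ^ 2 =
      (Real.exp s * (Real.exp t)⁻¹ + Real.exp t * (Real.exp s)⁻¹ - 2) / 4 := by
    have h2 := Real.cosh_two_mul ((s - t) / 2)
    rw [Real.cosh_sq, mul_div_cancel₀ _ two_ne_zero, Real.cosh_eq, neg_sub, Real.exp_sub,
      Real.exp_sub] at h2
    simp only [div_eq_mul_inv] at h2 ⊢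
    linarith
  rw [h1]
  field_simp
  unfold geodesicDenom
  have hp := Real.exp_pos s
  have hq := Real.exp_pos t
  generalize Real.exp s = p at *
  generalize Real.exp t = q at *
  field_simp
  ring

lemma geodesicCurve_mem_ball {η ξ : E n} (hη : η ∈ Boundary n) (hξ : ξ ∈ Boundary n)
    (h : η ≠ ξ) (t : ℝ) : geodesicCurve η ξ t ∈ Metric.ball (0 : E n) 1 := by
  rw [mem_ball_zero_iff]
  have h1 : 0 < ‖ξ - η‖ := norm_sub_pos_iff.2 h.symm
  have h2 : 0 < 1 - ‖geodesicCurve η ξ t‖ ^ 2 := by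
    rw [one_sub_norm_geodesicCurve_sq hη hξ]
    exact div_pos (by positivity) (geodesicDenom_pos η ξ t)
  nlinarith [norm_nonneg (geodesicCurve η ξ t)]

lemma tendsto_geodesicCurve_atTop (η ξ : E n) :
    Tendsto (geodesicCurve η ξ) atTop (𝓝 ξ) := by
  have hu : Tendsto (fun t : ℝ => (Real.exp t)⁻¹) atTop (𝓝 0) :=
    tendsto_inv_atTop_zero.comp Real.tendsto_exp_atTop
  have h1 : Tendsto (fun t : ℝ => (‖ξ - η‖ * (Real.exp t)⁻¹ + 1 + (Real.exp t)⁻¹ ^ 2)⁻¹ •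
      (ξ + (Real.exp t)⁻¹ ^ 2 • η)) atTop
      (𝓝 ((‖ξ - η‖ * 0 + 1 + 0 ^ 2)⁻¹ • (ξ + (0 : ℝ) ^ 2 • η))) :=
    ((((hu.const_mul _).add_const 1).add (hu.pow 2)).inv₀ (by norm_num)).smul
      (((hu.pow 2).smul_const η).const_add ξ)
  have h2 : (‖ξ - η‖ * 0 + 1 + 0 ^ 2)⁻¹ • (ξ + (0 : ℝ) ^ 2 • η) = ξ := by simp
  rw [h2] at h1
  refine h1.congr fun t => ?_
  have hp := Real.exp_pos t
  unfold geodesicCurve geodesicDenom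
  generalize Real.exp t = p at *
  rw [show ‖ξ - η‖ * p⁻¹ + 1 + p⁻¹ ^ 2 = p⁻¹ * (‖ξ - η‖ + p + p⁻¹) by field_simp,
    mul_inv, inv_inv, mul_comm, mul_smul, smul_add, smul_smul]
  congr 3
  field_simp

lemma geodesicCurve_neg (η ξ : E n) (t : ℝ) : geodesicCurve η ξ (-t) = geodesicCurve ξ η t := by
  unfold geodesicCurve geodesicDenom
  rw [Real.exp_neg, inv_inv, norm_sub_rev, add_comm (_ • ξ), add_assoc, add_assoc,
    add_comm (Real.exp t)]

/-- Two distinct points of the sphere are the end points of a geodesic. -/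
lemma exists_isGeodesicLine {η ξ : E n} (hη : η ∈ Boundary n) (hξ : ξ ∈ Boundary n)
    (h : η ≠ ξ) : ∃ γ : ℝ → Ball n, IsGeodesicLine γ η ξ := by
  refine ⟨fun t => ⟨geodesicCurve η ξ t, geodesicCurve_mem_ball hη hξ h t⟩, ?_, ?_,
    tendsto_geodesicCurve_atTop η ξ⟩
  · intro s t
    set x : Ball n := ⟨geodesicCurve η ξ s, geodesicCurve_mem_ball hη hξ h s⟩
    set y : Ball n := ⟨geodesicCurve η ξ t, geodesicCurve_mem_ball hη hξ h t⟩
    have h1 : sinhSq x y = Real.sinh ((s - t) / 2) ^ 2 := by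
      rw [sinhSq, div_eq_iff (mul_pos (one_sub_norm_sq_pos x) (one_sub_norm_sq_pos y)).ne']
      change ‖geodesicCurve η ξ s - geodesicCurve η ξ t‖ ^ 2 =
        _ * ((1 - ‖geodesicCurve η ξ s‖ ^ 2) * (1 - ‖geodesicCurve η ξ t‖ ^ 2))
      rw [norm_geodesicCurve_sub_sq hη hξ, one_sub_norm_geodesicCurve_sq hη hξ,
        one_sub_norm_geodesicCurve_sq hη hξ]
    rw [sinhSq_eq, sq_eq_sq_iff_abs_eq_abs, Real.abs_sinh, Real.abs_sinh, Real.sinh_inj,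
      abs_div, abs_div, abs_of_nonneg (hdist_nonneg x y)] at h1
    norm_num at h1
    linarith
  · refine ((tendsto_geodesicCurve_atTop ξ η).comp tendsto_neg_atBot_atTop).congr fun t => ?_
    rw [Function.comp_apply, geodesicCurve_neg]

/-- A point almost as close as `γ 0` to the points of a geodesic ray ending at `ξ` lies in a
definite horoball at `ξ`. -/
lemma IsGeodesicLine.horoLevel_le {γ : ℝ → Ball n} {η ξ : E n} (hγ : IsGeodesicLine γ η ξ)
    {y : Ball n} {t C : ℝ} (hy : hdist y (γ t) ≤ C + t) :
    horoLevel ξ y ≤ 4 * Real.exp C * horoLevel ξ (γ 0) := by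
  have hz := hγ.tendsto_top
  have hlim : ∀ y : Ball n, Tendsto
      (fun s => ‖(y : E n) - γ s‖ ^ 2 / (1 - ‖(y : E n)‖ ^ 2)) atTop (𝓝 (horoLevel ξ y)) :=
    fun y => ((hz.const_sub _).norm.pow 2).div_const _
  refine le_of_tendsto_of_tendsto (hlim y) ((hlim (γ 0)).const_mul _) ?_
  filter_upwards [eventually_ge_atTop t, eventually_ge_atTop 1] with s hs hs1
  rw [norm_sub_sq_div, norm_sub_sq_div, ← mul_assoc]
  refine mul_le_mul_of_nonneg_right ?_ (one_sub_norm_sq_pos _).le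
  have h1 : hdist y (γ s) ≤ C + s := by
    refine (hdist_triangle y (γ t) (γ s)).trans ?_
    rw [hγ.isometry, abs_of_nonpos (by linarith)]
    linarith
  have h2 : sinhSq (γ 0) (γ s) = Real.sinh (s / 2) ^ 2 := by
    rw [sinhSq_eq, hγ.isometry, zero_sub, abs_neg, abs_of_nonneg (by linarith)]
  -- For `s ≥ 1` the decaying term of `sinh (s / 2)` costs at most a factor `2`; squaring yields the
  -- `4` in the statement.
  have h3 : Real.sinh ((C + s) / 2) ≤ 2 * Real.exp (C / 2) * Real.sinh (s / 2) := by
    rw [Real.sinh_eq, Real.sinh_eq, add_div, Real.exp_add, Real.exp_neg (s / 2)]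
    have h4 : 2 ≤ Real.exp (s / 2) ^ 2 := by
      rw [← Real.exp_nat_mul]
      have := Real.add_one_le_exp (((2 : ℕ) : ℝ) * (s / 2))
      push_cast at this ⊢
      linarith
    have h5 : 2 * (Real.exp (s / 2))⁻¹ ≤ Real.exp (s / 2) := by
      rw [← div_eq_mul_inv, div_le_iff₀ (Real.exp_pos _)]
      nlinarith
    nlinarith [Real.exp_pos (C / 2), Real.exp_pos (-(C / 2 + s / 2)),
      mul_le_mul_of_nonneg_left h5 (Real.exp_pos (C / 2)).le]
  calc sinhSq y (γ s) ≤ Real.sinh ((C + s) / 2) ^ 2 := sinhSq_le_of_hdist_le h1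
    _ ≤ (2 * Real.exp (C / 2) * Real.sinh (s / 2)) ^ 2 := by
      refine pow_le_pow_left₀ (Real.sinh_nonneg_iff.2 ?_) h3 2
      linarith [hdist_nonneg y (γ s)]
    _ = 4 * Real.exp C * sinhSq (γ 0) (γ s) := by
      rw [h2, mul_pow, mul_pow, ← Real.exp_nat_mul, Nat.cast_ofNat,
        mul_div_cancel₀ _ two_ne_zero]
      norm_num

end Geodesic

/-! ### Bounded geometry along a geodesic in the hull. -/

section Group

variable {G : Subgroup (Equiv.Perm (Ball n))}

/-- A short loop at every point of the convex core. -/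
lemma IsKleinian.exists_short_of_injectivityRadius_le (hG : IsKleinian G) {M : ℝ≥0} {x : Ball n}
    (hx : injectivityRadius G (proj G x) ≤ M) :
    ∃ g ∈ G, g ≠ 1 ∧ hdist x (g x) ≤ 2 * (M + 1) := by
  -- The projection is not injective on some ball of radius `M + 1`. There `a = g b` with `a`, `b`
  -- near the lift `y`, so `g` moves `y` by less than `2 * (M + 1)`; conjugation by `h` carries this
  -- to `x`.
  have h1 : ¬ ∀ y : Ball n, proj G y = proj G x → InjOn (proj G) (hball y (M + 1 : ℝ≥0)) := by
    intro h
    have h2 : ((M + 1 : ℝ≥0) : ℝ≥0∞) ≤ M :=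
      (le_iSup₂ (f := fun (r : ℝ≥0) (_ : ∀ y : Ball n, proj G y = proj G x →
        InjOn (proj G) (hball y r)) => (r : ℝ≥0∞)) (M + 1) h).trans hx
    rw [ENNReal.coe_le_coe] at h2
    exact absurd h2 (not_le.2 (lt_add_one M))
  unfold InjOn at h1
  push Not at h1
  obtain ⟨y, hyx, a, ha, b, hb, hab, hne⟩ := h1
  obtain ⟨h, hh⟩ := Quotient.exact hyx
  obtain ⟨g, hg⟩ := Quotient.exact hab
  have hh' : (h : Equiv.Perm (Ball n)) x = y := hh
  have hg' : (g : Equiv.Perm (Ball n)) b = a := hg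
  have hay : hdist y a < M + 1 := by simpa [hball] using ha
  have hby : hdist y b < M + 1 := by simpa [hball] using hb
  refine ⟨(h : Equiv.Perm (Ball n))⁻¹ * g * h,
    G.mul_mem (G.mul_mem (G.inv_mem h.2) g.2) h.2, ?_, ?_⟩
  · intro hc
    have h3 : (g : Equiv.Perm (Ball n)) = 1 := by
      have := mul_eq_one_iff_eq_inv.1 hc
      exact mul_left_cancel (a := (h : Equiv.Perm (Ball n))⁻¹) (by rw [this, mul_one])
    rw [h3] at hg'
    exact hne hg'.symm
  · rw [← hG.isometry h h.2, Equiv.Perm.mul_apply, Equiv.Perm.mul_apply, hh',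
      show (h : Equiv.Perm (Ball n)) ((h : Equiv.Perm (Ball n))⁻¹ ((g : Equiv.Perm (Ball n)) y)) =
        (g : Equiv.Perm (Ball n)) y from Equiv.apply_symm_apply _ _]
    have h4 := hdist_triangle y a ((g : Equiv.Perm (Ball n)) y)
    have h5 : hdist a ((g : Equiv.Perm (Ball n)) y) = hdist y b := by
      rw [← hg', hG.isometry g g.2, hdist_comm]
    linarith

lemma geodesicLine_mem_limitHull {γ : ℝ → Ball n} {η ξ : E n} (hη : η ∈ limitSet G)
    (hξ : ξ ∈ limitSet G) (hγ : IsGeodesicLine γ η ξ) (t : ℝ) : γ t ∈ limitHull G :=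
  mem_sInter.2 fun _ hS => hS.2 ⟨η, hη, ξ, hξ, γ, hγ, mem_range_self t⟩

/-- The case of a geodesic in the convex hull of the limit set ending at `ξ`. -/
lemma IsKleinian.exists_horoball_of_isGeodesicLine (hG : IsKleinian G) (htf : IsTorsionFree G)
    (hbg : HasBoundedGeometryCore G) {γ : ℝ → Ball n} {η ξ : E n} (hη : η ∈ limitSet G)
    (hξ : ξ ∈ limitSet G) (hγ : IsGeodesicLine γ η ξ) (x : Ball n) :
    ∃ r : ℝ, 0 < r ∧ r < 1 ∧ (MulAction.orbit G x ∩ horoball ξ r).Infinite := by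
  obtain ⟨M, -, hM⟩ := hbg
  have hshort : ∀ k : ℕ, ∃ g ∈ G, g ≠ 1 ∧ hdist (γ k) (g (γ k)) ≤ 2 * (M + 1) := fun k =>
    hG.exists_short_of_injectivityRadius_le
      (hM _ (mem_image_of_mem _ (geodesicLine_mem_limitHull hη hξ hγ k)))
  choose g hgG hg1 hgd using hshort
  have hlevel : ∀ k, horoLevel ξ (g k x) ≤
      4 * Real.exp (hdist x (γ 0) + 2 * (M + 1)) * horoLevel ξ (γ 0) := by
    intro k
    refine hγ.horoLevel_le (t := k) ?_
    have h1 := hdist_triangle (g k x) (g k (γ k)) (γ k)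
    have h2 := hdist_triangle x (γ 0) (γ k)
    rw [hγ.isometry, zero_sub, abs_neg, abs_of_nonneg (Nat.cast_nonneg k)] at h2
    rw [hG.isometry _ (hgG k), hdist_comm (g k (γ k))] at h1
    linarith [hgd k]
  by_cases hfin : (range fun k => g k x).Finite
  · obtain ⟨y, hy⟩ : ∃ y, ∃ᶠ k in atTop, g k x = y := by
      by_contra! hc
      have := (hfin.eventually_all (p := fun y k => g k x ≠ y)).2 fun y _ => hc y
      obtain ⟨k, hk⟩ := this.exists
      exact hk _ (mem_range_self k) rfl
    obtain ⟨m, hm⟩ := hy.exists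
    -- Freeness turns a recurring orbit point into a recurring group element, whose action along
    -- these `k` shows that it fixes `ξ`.
    have hfreq : ∃ᶠ k : ℕ in atTop, g k = g m := hy.mono fun k hk =>
      hG.eq_of_apply_eq htf (hgG k) (hgG m) (hk.trans hm.symm)
    have : (atTop ⊓ 𝓟 {k : ℕ | g k = g m}).NeBot := frequently_mem_iff_neBot.1 hfreq
    have hz : Tendsto (fun k : ℕ => (γ k : E n)) (atTop ⊓ 𝓟 {k : ℕ | g k = g m}) (𝓝 ξ) :=
      (hγ.tendsto_top.comp tendsto_natCast_atTop_atTop).mono_left inf_le_left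
    refine hG.exists_horoball_of_fixed htf hξ.1 (hgG m) (hg1 m) hz
      (tendsto_of_hdist_le (C := 2 * (M + 1)) hξ.1 hz ?_) x
    filter_upwards [mem_inf_of_right (mem_principal_self _)] with k hk
    rw [← hk]
    exact hgd k
  · refine exists_horoball_of_infinite hξ.1
      (C := 4 * Real.exp (hdist x (γ 0) + 2 * (M + 1)) * horoLevel ξ (γ 0)) hfin ?_ ?_
    · rintro _ ⟨k, rfl⟩
      exact ⟨⟨g k, hgG k⟩, rfl⟩
    · rintro _ ⟨k, rfl⟩
      exact hlevel k

end Group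

end Hyperbolic

end

theorem mainTheorem6 (n : ℕ) (hn : 1 ≤ n)
    (G : Subgroup (Equiv.Perm (Hyperbolic.Ball n)))
    (hG : Hyperbolic.IsKleinian G) (htf : Hyperbolic.IsTorsionFree G)
    (hbg : Hyperbolic.HasBoundedGeometryCore G) :
    ∀ ξ ∈ Hyperbolic.limitSet G, ξ ∈ Hyperbolic.bigHorosphericLimitSet G := by
  refine fun ξ hξ => ⟨hξ, fun x => ?_⟩
  by_cases hL : ∀ η ∈ Hyperbolic.limitSet G, η = ξ
  · exact hG.exists_horoball_of_limitSet_subsingleton htf hξ hL x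
  · push Not at hL
    obtain ⟨η, hη, hne⟩ := hL
    obtain ⟨γ, hγ⟩ := Hyperbolic.exists_isGeodesicLine hη.1 hξ.1 hne
    exact hG.exists_horoball_of_isGeodesicLine htf hbg hη hξ hγ x
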